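/- Let $n\ge 3$ and let $\Gamma\subset\mathbb{R}^n$ be an open convex cone with vertex at the origin, symmetric under permutations of the coordinates, with $$\{\lambda\in\mathbb{R}^n:\lambda_i>0 \text{ for all } i\}\subset\Gamma\subset\{\lambda\in\mathbb{R}^n:\lambda_1+\dots+\lambda_n>0\}.$$ Let $(M^n,g)$ be a nonempty smooth compact Riemannian manifold with (possibly empty) boundary $\partial M$ and interior $M^\circ$. For a $C^2$ metric $\tilde g$, let $A_{\tilde g}=\frac{1}{n-2}\left(\mathrm{Ric}_{\tilde g}-\frac{R_{\tilde g}}{2(n-1)}\tilde g\right)$ be the Schouten tensor, $\lambda(A_{\tilde g})$ the vector of its eigenvalues with respect to $\tilde g$, and $h_{\tilde g}$ the (normalized) mean curvature of $\partial M$ with respect to the inner normal, positive for Euclidean balls. We say that $(M,g)$ is of $\Gamma$-positive type if there is a positive function $u\in C^2(M)$ such that $\tilde g=u^{\frac{4}{n-2}}g$ satisfies $\lambda(A_{\tilde g})\in\Gamma$ in $M$ and $h_{\tilde g}\ge 0$ on $\partial M$. We say that $(M,g)$ is of $\Gamma$-nonpositive type if there is a positive function $u\in C^{0,1}(M)$ that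 satisfies $\lambda(A_{u^{4/(n-2)}g})\in\partial\Gamma$ in $M^\circ$ and $h_{u^{4/(n-2)}g}\le 0$ on $\partial M$ in the viscosity sense, that is: (i) if $x_0\in M^\circ$, $\varphi\in C^2(M^\circ)$, $\varphi(x_0)=u(x_0)$ and $u\le\varphi$ near $x_0$, then $\lambda(A_{\varphi^{4/(n-2)}g}(x_0))\in\mathbb{R}^n\setminus\Gamma$; (ii) if $x_0\in M^\circ$, $\varphi\in C^2(M^\circ)$, $\varphi(x_0)=u(x_0)$ and $u\ge\varphi$ near $x_0$, then $\lambda(A_{\varphi^{4/(n-2)}g}(x_0))\in\overline{\Gamma}$; (iii) if $x_0\in\partial M$, $\varphi\in C^2(M)$, $\varphi(x_0)=u(x_0)$ and $u\le\varphi$ near $x_0$, then $h_{\varphi^{4/(n-2)}g}(x_0)\le 0$. Then $(M,g)$ cannot be simultaneously of $\Gamma$-positive type and of $\Gamma$-nonpositive type. -/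

import Mathlib

open scoped Manifold ContDiff Topology

noncomputable section

namespace GammaType

/-! ### Cones of eigenvalue vectors -/

/-- `Γ` is an open convex symmetric cone in `ℝⁿ` with vertex at the origin, and
`{l | ∀ i, 0 < l i} ⊆ Γ ⊆ {l | 0 < l₁ + ⋯ + lₙ}`. -/
structure IsAdmissibleCone {n : ℕ} (Γ : Set (Fin n → ℝ)) : Prop where
  isOpen : IsOpen Γ
  convex : Convex ℝ Γ
  symmetric : ∀ (σ : Equiv.Perm (Fin n)), ∀ l ∈ Γ, l ∘ σ ∈ Γ
  cone : ∀ t : ℝ, 0 < t → ∀ l ∈ Γ, t • l ∈ Γ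
  positive_subset : {l : Fin n → ℝ | ∀ i, 0 < l i} ⊆ Γ
  subset_halfspace : Γ ⊆ {l : Fin n → ℝ | 0 < ∑ i, l i}

/-- `l` lists, with multiplicity, the eigenvalues of the bilinear form with matrix `A`
with respect to the metric with matrix `G` (the eigenvalues of `G⁻¹ A`). -/
def IsEigenvalueVector {n : ℕ} (G A : Matrix (Fin n) (Fin n) ℝ) (l : Fin n → ℝ) : Prop :=
  (G⁻¹ * A).charpoly = ∏ i, (Polynomial.X - Polynomial.C (l i))

/-! ### Riemannian geometry in coordinates

Here `G` is a field of matrices `(g_ij)` on the closed half-space `{y | 0 ≤ y 0}` of `ℝⁿ`.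
All derivatives are taken within the half-space (they are one-sided in the direction `y 0`
at points with `y 0 = 0`, and the usual ones at points with `0 < y 0`). -/

section Coordinates

variable {n : ℕ} [NeZero n]

/-- The partial derivative `∂ᵢ f` at `y`, within the half-space. -/
def partialDeriv (i : Fin n) (f : EuclideanSpace ℝ (Fin n) → ℝ)
    (y : EuclideanSpace ℝ (Fin n)) : ℝ :=
  fderivWithin ℝ f (Set.range (𝓡∂ n)) y (EuclideanSpace.single i 1)

/-- The Christoffel symbol `Γᵏᵢⱼ = ½ gᵏˡ (∂ᵢ gⱼₗ + ∂ⱼ gᵢₗ - ∂ₗ gᵢⱼ)`. -/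
def christoffel (G : EuclideanSpace ℝ (Fin n) → Matrix (Fin n) (Fin n) ℝ) (k i j : Fin n)
    (y : EuclideanSpace ℝ (Fin n)) : ℝ :=
  (1 / 2) * ∑ l, (G y)⁻¹ k l *
    (partialDeriv i (fun z => G z j l) y + partialDeriv j (fun z => G z i l) y
      - partialDeriv l (fun z => G z i j) y)

/-- The Ricci curvature
`Ricᵢⱼ = ∂ₖ Γᵏᵢⱼ - ∂ⱼ Γᵏₖᵢ + Γᵏₖₗ Γˡᵢⱼ - Γᵏⱼₗ Γˡᵢₖ` (it is positive on round spheres). -/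
def ricci (G : EuclideanSpace ℝ (Fin n) → Matrix (Fin n) (Fin n) ℝ)
    (y : EuclideanSpace ℝ (Fin n)) : Matrix (Fin n) (Fin n) ℝ :=
  Matrix.of fun i j =>
    ∑ k, (partialDeriv k (christoffel G k i j) y - partialDeriv j (christoffel G k k i) y)
      + ∑ k, ∑ l, (christoffel G k k l y * christoffel G l i j y
          - christoffel G k j l y * christoffel G l i k y)

/-- The scalar curvature `R = gⁱʲ Ricᵢⱼ`. -/
def scalarCurvature (G : EuclideanSpace ℝ (Fin n) → Matrix (Fin n) (Fin n) ℝ)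
    (y : EuclideanSpace ℝ (Fin n)) : ℝ :=
  ∑ i, ∑ j, (G y)⁻¹ i j * ricci G y i j

/-- The Schouten tensor `A = (n - 2)⁻¹ (Ric - R / (2 (n - 1)) g)`. -/
def schouten (G : EuclideanSpace ℝ (Fin n) → Matrix (Fin n) (Fin n) ℝ)
    (y : EuclideanSpace ℝ (Fin n)) : Matrix (Fin n) (Fin n) ℝ :=
  (1 / ((n : ℝ) - 2)) •
    (ricci G y - (scalarCurvature G y / (2 * ((n : ℝ) - 1))) • G y)

/-- The components `ν_k = ⟨ν, ∂ₖ⟩` of the outer unit normal `ν = -∇y₀ / |∇y₀|`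
of the half-space `{0 ≤ y₀}`, where `|∇y₀|² = g⁰⁰`. -/
def outerConormal (G : EuclideanSpace ℝ (Fin n) → Matrix (Fin n) (Fin n) ℝ)
    (y : EuclideanSpace ℝ (Fin n)) (k : Fin n) : ℝ :=
  if k = 0 then -(1 / Real.sqrt ((G y)⁻¹ 0 0)) else 0

/-- The components `νᵏ = gᵏˡ ν_l` of the outer unit normal. -/
def outerNormal (G : EuclideanSpace ℝ (Fin n) → Matrix (Fin n) (Fin n) ℝ)
    (y : EuclideanSpace ℝ (Fin n)) (k : Fin n) : ℝ :=
  ∑ l, (G y)⁻¹ k l * outerConormal G y l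

/-- The mean curvature of `{y₀ = 0}`: the normalized trace
`(n - 1)⁻¹ (gⁱʲ - νⁱ νʲ) IIᵢⱼ`, over the directions tangent to the boundary, of the second
fundamental form with respect to the inner normal `-ν`,
`IIᵢⱼ = ⟨∇_{∂ᵢ} ∂ⱼ, -ν⟩ = -Γᵏᵢⱼ ν_k`. It is positive for Euclidean balls. -/
def meanCurvature (G : EuclideanSpace ℝ (Fin n) → Matrix (Fin n) (Fin n) ℝ)
    (y : EuclideanSpace ℝ (Fin n)) : ℝ :=
  (1 / ((n : ℝ) - 1)) * ∑ i, ∑ j,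
    ((G y)⁻¹ i j - outerNormal G y i * outerNormal G y j) *
      (-∑ k, christoffel G k i j y * outerConormal G y k)

end Coordinates

/-! ### Metrics on a manifold with boundary -/

section Manifold

variable {n : ℕ} [NeZero n]

/-- A field of bilinear forms on the tangent spaces of an `n`-manifold with boundary. -/
abbrev BilinField (n : ℕ) [NeZero n] (M : Type*) [TopologicalSpace M]
    [ChartedSpace (EuclideanHalfSpace n) M] : Type _ :=
  ∀ x : M, TangentSpace (𝓡∂ n) x →L[ℝ] TangentSpace (𝓡∂ n) x →L[ℝ] ℝ

variable {M : Type*} [TopologicalSpace M] [ChartedSpace (EuclideanHalfSpace n) M]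

/-- The coordinate vector field `∂ᵢ` of the chart `e` at the point with coordinates `y`. -/
def coordVector (e : OpenPartialHomeomorph M (EuclideanHalfSpace n))
    (y : EuclideanSpace ℝ (Fin n)) (i : Fin n) :
    TangentSpace (𝓡∂ n) ((e.extend (𝓡∂ n)).symm y) :=
  mfderivWithin 𝓘(ℝ, EuclideanSpace ℝ (Fin n)) (𝓡∂ n) (e.extend (𝓡∂ n)).symm
    (Set.range (𝓡∂ n)) y (EuclideanSpace.single i (1 : ℝ) : EuclideanSpace ℝ (Fin n))

/-- The matrix `gᵢⱼ = g(∂ᵢ, ∂ⱼ)` of `g` in the chart `e`, as a function of the coordinates. -/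
def coordMatrix (g : BilinField n M) (e : OpenPartialHomeomorph M (EuclideanHalfSpace n))
    (y : EuclideanSpace ℝ (Fin n)) : Matrix (Fin n) (Fin n) ℝ :=
  Matrix.of fun i j => g ((e.extend (𝓡∂ n)).symm y) (coordVector e y i) (coordVector e y j)

/-- `λ(A_g) ∈ S` at the point `x`, for a symmetric set `S`: the eigenvalues of the Schouten tensor
of `g` with respect to `g`, computed in smooth charts around `x`, form a vector of `S`.
(The eigenvalues do not depend on the chart.) -/
def SchoutenEigenvaluesIn (g : BilinField n M) (S : Set (Fin n → ℝ)) (x : M) : Prop :=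
  ∀ e ∈ IsManifold.maximalAtlas (𝓡∂ n) ∞ M, x ∈ e.source →
    ∃ l ∈ S, IsEigenvalueVector (coordMatrix g e (e.extend (𝓡∂ n) x))
      (schouten (coordMatrix g e) (e.extend (𝓡∂ n) x)) l

/-- `h_g ∈ S` at the boundary point `x`: the mean curvature of the boundary at `x`,
computed in smooth charts around `x`, lies in `S`. (It does not depend on the chart.) -/
def MeanCurvatureIn (g : BilinField n M) (S : Set ℝ) (x : M) : Prop :=
  ∀ e ∈ IsManifold.maximalAtlas (𝓡∂ n) ∞ M, x ∈ e.source →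
    meanCurvature (coordMatrix g e) (e.extend (𝓡∂ n) x) ∈ S

/-- The conformal metric `u^{4/(n-2)} g`. -/
def conformal (g : BilinField n M) (u : M → ℝ) : BilinField n M :=
  fun x => (u x ^ (4 / ((n : ℝ) - 2))) • g x

/-- `u` is of class `C^{0,1}`: it is locally Lipschitz, up to the boundary, in smooth charts. -/
def IsLipschitzFunction (u : M → ℝ) : Prop :=
  ∀ e ∈ IsManifold.maximalAtlas (𝓡∂ n) ∞ M,
    LocallyLipschitzOn (e.extend (𝓡∂ n)).target (u ∘ (e.extend (𝓡∂ n)).symm)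

/-- The positive continuous function `u` is a viscosity supersolution of
`λ(A_{u^{4/(n-2)} g}) ∈ ∂Γ` in the interior of `M`. -/
def IsViscositySupersolution (Γ : Set (Fin n → ℝ)) (g : BilinField n M) (u : M → ℝ) : Prop :=
  Continuous u ∧ (∀ x, 0 < u x) ∧
    ∀ x₀ ∈ (𝓡∂ n).interior M, ∀ φ : M → ℝ,
      ContMDiffOn (𝓡∂ n) 𝓘(ℝ, ℝ) 2 φ ((𝓡∂ n).interior M) →
      u x₀ = φ x₀ → (∀ᶠ x in 𝓝 x₀, u x ≤ φ x) →
      SchoutenEigenvaluesIn (conformal g φ) Γᶜ x₀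

/-- The positive continuous function `u` is a viscosity subsolution of
`λ(A_{u^{4/(n-2)} g}) ∈ ∂Γ` in the interior of `M`. -/
def IsViscositySubsolution (Γ : Set (Fin n → ℝ)) (g : BilinField n M) (u : M → ℝ) : Prop :=
  Continuous u ∧ (∀ x, 0 < u x) ∧
    ∀ x₀ ∈ (𝓡∂ n).interior M, ∀ φ : M → ℝ,
      ContMDiffOn (𝓡∂ n) 𝓘(ℝ, ℝ) 2 φ ((𝓡∂ n).interior M) →
      u x₀ = φ x₀ → (∀ᶠ x in 𝓝 x₀, φ x ≤ u x) →
      SchoutenEigenvaluesIn (conformal g φ) (closure Γ) x₀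

/-- The inequality `h_{u^{4/(n-2)} g} ≤ 0` on the boundary of `M`, in the viscosity sense:
it holds for every `C²` function, up to the boundary, that touches `u` from above at a boundary
point. -/
def MeanCurvatureNonposViscosity (g : BilinField n M) (u : M → ℝ) : Prop :=
  ∀ x₀ ∈ (𝓡∂ n).boundary M, ∀ φ : M → ℝ,
    ContMDiff (𝓡∂ n) 𝓘(ℝ, ℝ) 2 φ →
    u x₀ = φ x₀ → (∀ᶠ x in 𝓝 x₀, u x ≤ φ x) →
    MeanCurvatureIn (conformal g φ) (Set.Iic 0) x₀

/-- `(M, g)` is of `Γ`-positive type. -/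
def IsPositiveType (Γ : Set (Fin n → ℝ)) (g : BilinField n M) : Prop :=
  ∃ u : M → ℝ, ContMDiff (𝓡∂ n) 𝓘(ℝ, ℝ) 2 u ∧ (∀ x, 0 < u x) ∧
    (∀ x, SchoutenEigenvaluesIn (conformal g u) Γ x) ∧
    ∀ x ∈ (𝓡∂ n).boundary M, MeanCurvatureIn (conformal g u) (Set.Ici 0) x

/-- `(M, g)` is of `Γ`-nonpositive type. -/
def IsNonpositiveType (Γ : Set (Fin n → ℝ)) (g : BilinField n M) : Prop :=
  ∃ u : M → ℝ, IsLipschitzFunction (n := n) u ∧ (∀ x, 0 < u x) ∧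
    IsViscositySupersolution Γ g u ∧ IsViscositySubsolution Γ g u ∧
    MeanCurvatureNonposViscosity g u

end Manifold

end GammaType

end

/-!
Let `v` and `u` be the functions given by the positive and the nonpositive type. By compactness
`u / v` attains its maximum at some `x₀`, and a constant multiple `w` of `v` touches `u` from above
at `x₀`; the conditions on `v` pass to `w`, since multiplying the metric by a constant preserves the
Schouten tensor (`schouten_smul`) and the sign of the mean curvature (`meanCurvature_smul`).

If `x₀` is an interior point, `w` is itself a test function, and the eigenvalues of its Schouten
tensor lie both in `Γ` and outside of it. They are determined up to a permutation
(`IsEigenvalueVector.exists_perm`), which is absurd because `Γ` is symmetric.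

If `x₀` is a boundary point, the two conditions on the mean curvature are compatible, and `w` has to
be perturbed. In the chart at `x₀`, with the boundary at `y 0 = 0`, let `φ` be
`w + δ |y - y₀|² - δ² y 0 + t`, cut off away from `x₀` (`cutoffSqDist`, `cutoffHeight`), with `t`
such that `φ` touches `u` from above at some point `x`. Comparison with `x₀` gives
`|y - y₀|² ≤ δ y 0` at `x`, hence `x` is within `δ` of `x₀`, and it is either interior or equal to
`x₀` (`mem_source_of_cutoffSqDist_le`). In the second case the term `- δ² y 0` makes the mean
curvature of `φ` at `x₀` larger than that of `w`, thus positive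
(`meanCurvature_lt_of_partialDeriv`), against the boundary condition for `u`. In the first case the
Schouten tensor of `φ` at `x` has eigenvalues outside of `Γ`. Let `δ → 0`: the Schouten tensor
depends continuously on parameters (`continuousWithinAt_inv_mul_schouten`), and the complement of
`Γ` is closed, so `w` itself would have eigenvalues outside of `Γ` at `x₀`
(`exists_isEigenvalueVector_of_tendsto`).

Everything is computed in the single chart at `x₀`. The only comparison of charts is the fact that
interior points are detected by any chart.
-/

noncomputable section

namespace GammaType

/-! ### Eigenvalue vectors -/

section Eigenvalues

open Filter Set

/-- The eigenvalue vector of a pair of matrices is unique up to a permutation. -/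
theorem IsEigenvalueVector.exists_perm {n : ℕ} {G A : Matrix (Fin n) (Fin n) ℝ}
    {l l' : Fin n → ℝ} (h : IsEigenvalueVector G A l) (h' : IsEigenvalueVector G A l') :
    ∃ σ : Equiv.Perm (Fin n), l' = l ∘ σ := by
  have key : Multiset.map l Finset.univ.val = Multiset.map l' Finset.univ.val := by
    have e : (∏ i, (Polynomial.X - Polynomial.C (l i)))
        = ∏ i, (Polynomial.X - Polynomial.C (l' i)) := h.symm.trans h'
    have r : ∀ m : Fin n → ℝ, (∏ i, (Polynomial.X - Polynomial.C (m i))).roots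
        = Multiset.map m Finset.univ.val := by
      intro m
      rw [← Polynomial.roots_multiset_prod_X_sub_C (Multiset.map m Finset.univ.val),
        Multiset.map_map]
      rfl
    rw [← r, ← r, e]
  rw [Fin.univ_val_map, Fin.univ_val_map, Multiset.coe_eq_coe] at key
  -- Both vectors have the same increasing rearrangement.
  have hsort : l ∘ Tuple.sort l = l' ∘ Tuple.sort l' := by
    refine List.ofFn_injective ?_
    refine (((Tuple.sort l).ofFn_comp_perm l).trans
      (key.trans ((Tuple.sort l').ofFn_comp_perm l').symm)).eq_of_pairwise'
      (Tuple.monotone_sort l).sortedLE_ofFn.pairwise (Tuple.monotone_sort l').sortedLE_ofFn.pairwise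
  refine ⟨(Tuple.sort l')⁻¹.trans (Tuple.sort l), funext fun i => ?_⟩
  have := congrFun hsort ((Tuple.sort l')⁻¹ i)
  simpa using this.symm

section Limit

attribute [local instance] Matrix.linftyOpNormedRing Matrix.linftyOpNormedAlgebra

theorem abs_le_linftyOpNorm_of_isRoot_charpoly {n : ℕ} {A : Matrix (Fin n) (Fin n) ℝ} {μ : ℝ}
    (h : A.charpoly.IsRoot μ) : |μ| ≤ ‖A‖ := by
  rw [← Matrix.mem_spectrum_iff_isRoot_charpoly] at h
  have : Nonempty (Fin n) := by
    by_contra hn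
    rw [not_nonempty_iff] at hn
    rw [spectrum.of_subsingleton] at h
    exact h
  exact spectrum.norm_le_norm_of_mem h

/-- Eigenvalue vectors lying in a closed set persist in the limit: they stay bounded, and a limit
point of them lists the eigenvalues of the limit matrix. -/
theorem exists_isEigenvalueVector_of_tendsto {n : ℕ} {G A : ℕ → Matrix (Fin n) (Fin n) ℝ}
    {G₀ A₀ : Matrix (Fin n) (Fin n) ℝ}
    (hlim : Tendsto (fun k => (G k)⁻¹ * A k) atTop (𝓝 (G₀⁻¹ * A₀)))
    {S : Set (Fin n → ℝ)} (hS : IsClosed S)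
    (h : ∃ᶠ k in atTop, ∃ l ∈ S, IsEigenvalueVector (G k) (A k) l) :
    ∃ l ∈ S, IsEigenvalueVector G₀ A₀ l := by
  obtain ⟨ψ, hψ, hl⟩ := extraction_of_frequently_atTop h
  choose l hlS hl using hl
  have hlim' := hlim.comp hψ.tendsto_atTop
  obtain ⟨C, hC⟩ := hlim'.norm.bddAbove_range
  have hb : ∀ k, l k ∈ Metric.closedBall (0 : Fin n → ℝ) (max C 0) := by
    intro k
    rw [mem_closedBall_zero_iff, pi_norm_le_iff_of_nonneg (le_max_right _ _)]
    intro i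
    refine le_trans ?_ ((hC (mem_range_self k)).trans (le_max_left _ _))
    refine abs_le_linftyOpNorm_of_isRoot_charpoly ?_
    change Polynomial.IsRoot ((G (ψ k))⁻¹ * A (ψ k)).charpoly _
    rw [show ((G (ψ k))⁻¹ * A (ψ k)).charpoly = _ from hl k, Polynomial.IsRoot,
      Polynomial.eval_prod]
    exact Finset.prod_eq_zero (Finset.mem_univ i) (by simp)
  obtain ⟨l₀, -, θ, hθ, hl₀⟩ := tendsto_subseq_of_bounded Metric.isBounded_closedBall hb
  refine ⟨l₀, hS.mem_of_tendsto hl₀ (Eventually.of_forall fun k => hlS _), ?_⟩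
  refine Polynomial.funext fun μ => ?_
  have h1 : Tendsto (fun k => ((G (ψ (θ k)))⁻¹ * A (ψ (θ k))).charpoly.eval μ) atTop
      (𝓝 ((G₀⁻¹ * A₀).charpoly.eval μ)) := by
    simp only [Matrix.eval_charpoly]
    have hc : Continuous fun B : Matrix (Fin n) (Fin n) ℝ => (Matrix.scalar (Fin n) μ - B).det :=
      (continuous_const.sub continuous_id).matrix_det
    exact (hc.tendsto _).comp (hlim'.comp hθ.tendsto_atTop)
  have h2 : Tendsto (fun k => ((G (ψ (θ k)))⁻¹ * A (ψ (θ k))).charpoly.eval μ) atTop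
      (𝓝 ((∏ i, (Polynomial.X - Polynomial.C (l₀ i))).eval μ)) := by
    have e : ∀ k, ((G (ψ (θ k)))⁻¹ * A (ψ (θ k))).charpoly.eval μ = ∏ i, (μ - l (θ k) i) := by
      intro k
      rw [show ((G (ψ (θ k)))⁻¹ * A (ψ (θ k))).charpoly = _ from hl (θ k), Polynomial.eval_prod]
      simp
    simp only [e, Polynomial.eval_prod, Polynomial.eval_sub, Polynomial.eval_X, Polynomial.eval_C]
    exact tendsto_finsetProd _ fun i _ =>
      tendsto_const_nhds.sub ((tendsto_pi_nhds.1 hl₀) i)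
  exact tendsto_nhds_unique h1 h2

end Limit

end Eigenvalues

/-! ### Smooth dependence of the curvature on parameters -/

section Parameters

variable {n : ℕ} [NeZero n] {P : Type*} [NormedAddCommGroup P] [NormedSpace ℝ P]

variable (n P) in
/-- The set of pairs (parameter, point of the closed half-space). -/
abbrev paramHalfSpace : Set (P × EuclideanSpace ℝ (Fin n)) := Set.univ ×ˢ Set.range (𝓡∂ n)

/-- Partial derivatives in `y` of a function of `(p, y)` of class `C^(m+1)` are jointly `C^m`. -/
theorem contDiffWithinAt_partialDeriv {f : P → EuclideanSpace ℝ (Fin n) → ℝ} {m k : ℕ∞ω}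
    (hm : m + 1 ≤ k) {q : P × EuclideanSpace ℝ (Fin n)} (hq : q.2 ∈ Set.range (𝓡∂ n))
    (hf : ContDiffWithinAt ℝ k (fun z : P × EuclideanSpace ℝ (Fin n) => f z.1 z.2)
      (paramHalfSpace n P) q) (i : Fin n) :
    ContDiffWithinAt ℝ m (fun z : P × EuclideanSpace ℝ (Fin n) => partialDeriv i (f z.1) z.2)
      (paramHalfSpace n P) q := by
  refine ContDiffWithinAt.fderivWithin_apply (f := fun z : P × EuclideanSpace ℝ (Fin n) => f z.1)
      (g := Prod.snd)
    (k := fun _ => EuclideanSpace.single i 1) (n := k) ?_ contDiffWithinAt_snd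
    contDiffWithinAt_const (𝓡∂ n).uniqueDiffOn hm ⟨Set.mem_univ _, hq⟩ fun z hz => hz.2
  exact ContDiffWithinAt.comp (q, q.2) (g := fun z : P × EuclideanSpace ℝ (Fin n) => f z.1 z.2)
    (f := fun z : (P × EuclideanSpace ℝ (Fin n)) × EuclideanSpace ℝ (Fin n) => (z.1.1, z.2)) hf
    (contDiff_fst.fst.prodMk contDiff_snd).contDiffWithinAt fun z hz => ⟨Set.mem_univ _, hz.2⟩

theorem contDiffWithinAt_matrix_det {X ι : Type*} [NormedAddCommGroup X] [NormedSpace ℝ X]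
    [Fintype ι] [DecidableEq ι] {A : X → Matrix ι ι ℝ} {k : ℕ∞ω} {s : Set X} {x : X}
    (hA : ∀ i j, ContDiffWithinAt ℝ k (fun z => A z i j) s x) :
    ContDiffWithinAt ℝ k (fun z => (A z).det) s x := by
  simp only [Matrix.det_apply]
  exact ContDiffWithinAt.sum fun σ _ =>
    (contDiffWithinAt_prod fun i _ => hA _ _).const_smul _

theorem contDiffWithinAt_matrix_inv {X ι : Type*} [NormedAddCommGroup X] [NormedSpace ℝ X]
    [Fintype ι] [DecidableEq ι] {A : X → Matrix ι ι ℝ} {k : ℕ∞ω} {s : Set X} {x : X}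
    (hA : ∀ i j, ContDiffWithinAt ℝ k (fun z => A z i j) s x) (hdet : (A x).det ≠ 0) (i j : ι) :
    ContDiffWithinAt ℝ k (fun z => (A z)⁻¹ i j) s x := by
  simp only [Matrix.inv_def, Ring.inverse_eq_inv', Matrix.smul_apply, smul_eq_mul,
    Matrix.adjugate_apply]
  refine ((contDiffWithinAt_matrix_det hA).inv hdet).mul (contDiffWithinAt_matrix_det ?_)
  intro a b
  by_cases h : a = j
  · subst h
    simpa using contDiffWithinAt_const
  · simpa [Matrix.updateRow_ne h] using hA a b

theorem contDiffWithinAt_christoffel {G : P → EuclideanSpace ℝ (Fin n) → Matrix (Fin n) (Fin n) ℝ}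
    {m k : ℕ∞ω}
    (hm : m + 1 ≤ k) {q : P × EuclideanSpace ℝ (Fin n)} (hq : q.2 ∈ Set.range (𝓡∂ n))
    (hG : ∀ i j, ContDiffWithinAt ℝ k (fun z : P × EuclideanSpace ℝ (Fin n) => G z.1 z.2 i j)
      (paramHalfSpace n P) q)
    (hdet : (G q.1 q.2).det ≠ 0) (a i j : Fin n) :
    ContDiffWithinAt ℝ m (fun z : P × EuclideanSpace ℝ (Fin n) => christoffel (G z.1) a i j z.2)
      (paramHalfSpace n P) q := by
  have hd : ∀ a b c, ContDiffWithinAt ℝ m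
      (fun z : P × EuclideanSpace ℝ (Fin n) => partialDeriv a (fun y => G z.1 y b c) z.2)
        (paramHalfSpace n P) q := fun a b c =>
    contDiffWithinAt_partialDeriv (f := fun p y => G p y b c) hm hq (hG b c) a
  unfold christoffel
  refine contDiffWithinAt_const.mul (ContDiffWithinAt.sum fun l _ => ?_)
  refine ((contDiffWithinAt_matrix_inv (A := fun z : P × EuclideanSpace ℝ (Fin n) =>
      G z.1 z.2) hG hdet _ _).of_le
    (le_self_add.trans hm)).mul ?_
  exact ((hd _ _ _).add (hd _ _ _)).sub (hd _ _ _)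

theorem continuousWithinAt_ricci {G : P → EuclideanSpace ℝ (Fin n) → Matrix (Fin n) (Fin n) ℝ}
    {q : P × EuclideanSpace ℝ (Fin n)} (hq : q.2 ∈ Set.range (𝓡∂ n))
    (hG : ∀ i j, ContDiffWithinAt ℝ 2 (fun z : P × EuclideanSpace ℝ (Fin n) => G z.1 z.2 i j)
      (paramHalfSpace n P) q)
    (hdet : (G q.1 q.2).det ≠ 0) (i j : Fin n) :
    ContinuousWithinAt (fun z : P × EuclideanSpace ℝ (Fin n) => ricci (G z.1) z.2 i j)
      (paramHalfSpace n P) q := by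
  have h1 : ∀ a i j, ContDiffWithinAt ℝ 1 (fun z : P × EuclideanSpace ℝ (Fin n) => christoffel
      (G z.1) a i j z.2)
    (paramHalfSpace n P) q :=
    contDiffWithinAt_christoffel (by norm_num) hq hG hdet
  have h2 : ∀ b a i j, ContinuousWithinAt
      (fun z : P × EuclideanSpace ℝ (Fin n) => partialDeriv b (christoffel (G z.1) a i j) z.2)
        (paramHalfSpace n P) q := fun b a i j =>
    (contDiffWithinAt_partialDeriv (f := fun p => christoffel (G p) a i j) (m := 0) (k := 1)
      (by simp) hq
      (h1 a i j) b).continuousWithinAt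
  have h3 := fun a i j => (h1 a i j).continuousWithinAt
  simp only [ricci, Matrix.of_apply]
  refine ContinuousWithinAt.add ?_ ?_
  · exact tendsto_finsetSum _ fun k _ => (h2 _ _ _ _).sub (h2 _ _ _ _)
  · exact tendsto_finsetSum _ fun k _ => tendsto_finsetSum _ fun l _ =>
      ((h3 _ _ _).mul (h3 _ _ _)).sub ((h3 _ _ _).mul (h3 _ _ _))

/-- The endomorphism `G⁻¹ A` whose eigenvalues are those of the Schouten tensor depends
continuously on parameters and on the point, if the metric is jointly `C²` in them. -/
theorem continuousWithinAt_inv_mul_schouten {G : P → EuclideanSpace ℝ (Fin n) → Matrix (Fin n)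
    (Fin n) ℝ}
    {q : P × EuclideanSpace ℝ (Fin n)} (hq : q.2 ∈ Set.range (𝓡∂ n))
    (hG : ∀ i j, ContDiffWithinAt ℝ 2 (fun z : P × EuclideanSpace ℝ (Fin n) => G z.1 z.2 i j)
      (paramHalfSpace n P) q)
    (hdet : (G q.1 q.2).det ≠ 0) :
    ContinuousWithinAt (fun z : P × EuclideanSpace ℝ (Fin n) => (G z.1 z.2)⁻¹ * schouten
        (G z.1) z.2)
      (paramHalfSpace n P) q := by
  have hr := continuousWithinAt_ricci hq hG hdet
  have hi : ∀ i j, ContinuousWithinAt (fun z : P × EuclideanSpace ℝ (Fin n) => (G z.1 z.2)⁻¹ i j)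
    (paramHalfSpace n P) q := fun i j =>
    (contDiffWithinAt_matrix_inv (A := fun z : P × EuclideanSpace ℝ (Fin n) =>
        G z.1 z.2) hG hdet i j).continuousWithinAt
  have hs : ContinuousWithinAt (fun z : P × EuclideanSpace ℝ (Fin n) => scalarCurvature (G z.1) z.2)
    (paramHalfSpace n P) q :=
    tendsto_finsetSum _ fun k _ => tendsto_finsetSum _ fun l _ => (hi _ _).mul (hr _ _)
  refine continuousWithinAt_pi.2 fun i => continuousWithinAt_pi.2 fun j => ?_
  simp only [Matrix.mul_apply, schouten, Matrix.smul_apply, Matrix.sub_apply, smul_eq_mul]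
  exact tendsto_finsetSum _ fun k _ => (hi _ _).mul (continuousWithinAt_const.mul
    ((hr _ _).sub ((hs.div_const _).mul (hG _ _).continuousWithinAt)))

end Parameters

/-! ### Metrics multiplied by constants -/

section Scaling

variable {n : ℕ}

theorem inv_smul_matrix {G : Matrix (Fin n) (Fin n) ℝ} (hG : IsUnit G.det) {c : ℝ} (hc : c ≠ 0) :
    (c • G)⁻¹ = c⁻¹ • G⁻¹ := by
  let _ := invertibleOfNonzero hc
  rw [Matrix.inv_smul G c hG, invOf_eq_inv]

theorem IsEigenvalueVector.smul_metric {G A : Matrix (Fin n) (Fin n) ℝ} {l : Fin n → ℝ}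
    (h : IsEigenvalueVector G A l) (hG : IsUnit G.det) {c : ℝ} (hc : c ≠ 0) :
    IsEigenvalueVector (c • G) A (c⁻¹ • l) := by
  refine Polynomial.funext fun μ => ?_
  have h1 := congrArg (Polynomial.eval (c * μ)) h
  simp only [Matrix.eval_charpoly, Polynomial.eval_prod, Polynomial.eval_sub, Polynomial.eval_X,
    Polynomial.eval_C] at h1 ⊢
  have h2 : Matrix.scalar (Fin n) μ - (c • G)⁻¹ * A
      = c⁻¹ • (Matrix.scalar (Fin n) (c * μ) - G⁻¹ * A) := by
    rw [inv_smul_matrix hG hc, smul_sub, Matrix.smul_mul]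
    congr 1
    ext i j
    by_cases hij : i = j
    · subst hij; simp [hc]
    · simp [hij]
  rw [h2, Matrix.det_smul, h1, Fintype.card_fin, ← Fin.prod_const, ← Finset.prod_mul_distrib]
  refine Finset.prod_congr rfl fun i _ => ?_
  simp only [Pi.smul_apply, smul_eq_mul]
  field_simp

variable [NeZero n] {G : EuclideanSpace ℝ (Fin n) → Matrix (Fin n) (Fin n) ℝ}
  {y : EuclideanSpace ℝ (Fin n)} {c : ℝ}

theorem partialDeriv_const_mul (hy : y ∈ Set.range (𝓡∂ n)) (i : Fin n)
    (f : EuclideanSpace ℝ (Fin n) → ℝ) (c : ℝ) :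
    partialDeriv i (fun z => c * f z) y = c * partialDeriv i f y := by
  unfold partialDeriv
  rw [show (fun z => c * f z) = c • f from rfl,
    fderivWithin_const_smul_field c ((𝓡∂ n).uniqueDiffOn y hy)]
  rfl

theorem christoffel_smul (hy : y ∈ Set.range (𝓡∂ n)) (hG : IsUnit (G y).det) (hc : c ≠ 0)
    (k i j : Fin n) :
    christoffel (fun z => c • G z) k i j y = christoffel G k i j y := by
  simp only [christoffel, inv_smul_matrix hG hc, Matrix.smul_apply, smul_eq_mul,
    partialDeriv_const_mul hy]
  congr 1
  refine Finset.sum_congr rfl fun l _ => ?_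
  field_simp

theorem ricci_smul (hG : ∀ᶠ z in 𝓝[Set.range (𝓡∂ n)] y, IsUnit (G z).det)
    (hy : y ∈ Set.range (𝓡∂ n)) (hc : c ≠ 0) :
    ricci (fun z => c • G z) y = ricci G y := by
  have h : ∀ k i j, christoffel (fun z => c • G z) k i j
      =ᶠ[𝓝[Set.range (𝓡∂ n)] y] christoffel G k i j := fun k i j =>
    by filter_upwards [hG, self_mem_nhdsWithin] with z hz hzr using christoffel_smul hzr hz hc k i j
  have h0 : ∀ k i j, christoffel (fun z => c • G z) k i j y = christoffel G k i j y :=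
    fun k i j => (h k i j).eq_of_nhdsWithin hy
  have h1 : ∀ a k i j, partialDeriv a (christoffel (fun z => c • G z) k i j) y
      = partialDeriv a (christoffel G k i j) y := by
    intro a k i j
    unfold partialDeriv
    rw [(h k i j).fderivWithin_eq (h0 k i j)]
  ext i j
  simp only [ricci, Matrix.of_apply, h0, h1]

/-- The Schouten tensor does not change when the metric is multiplied by a constant. -/
theorem schouten_smul (hG : ∀ᶠ z in 𝓝[Set.range (𝓡∂ n)] y, IsUnit (G z).det)
    (hy : y ∈ Set.range (𝓡∂ n)) (hc : c ≠ 0) :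
    schouten (fun z => c • G z) y = schouten G y := by
  have hs : scalarCurvature (fun z => c • G z) y = c⁻¹ * scalarCurvature G y := by
    simp only [scalarCurvature, ricci_smul hG hy hc, inv_smul_matrix (hG.self_of_nhdsWithin hy) hc,
      Matrix.smul_apply, smul_eq_mul, Finset.mul_sum, mul_assoc]
  simp only [schouten, hs, ricci_smul hG hy hc, smul_smul]
  congr 3
  field_simp

theorem meanCurvature_smul (hy : y ∈ Set.range (𝓡∂ n)) (hG : IsUnit (G y).det) (hc : 0 < c) :
    meanCurvature (fun z => c • G z) y = (Real.sqrt c)⁻¹ * meanCurvature G y := by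
  have hco : ∀ k, outerConormal (fun z => c • G z) y k = Real.sqrt c * outerConormal G y k := by
    intro k
    simp only [outerConormal, inv_smul_matrix hG hc.ne', Matrix.smul_apply, smul_eq_mul]
    split_ifs
    · rw [Real.sqrt_mul (by positivity), Real.sqrt_inv]
      simp [mul_comm]
    · simp
  have hno : ∀ k, outerNormal (fun z => c • G z) y k = (Real.sqrt c)⁻¹ * outerNormal G y k := by
    intro k
    simp only [outerNormal, hco, inv_smul_matrix hG hc.ne', Matrix.smul_apply, smul_eq_mul,
      Finset.mul_sum]
    refine Finset.sum_congr rfl fun l _ => ?_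
    have h1 : Real.sqrt c ≠ 0 := (Real.sqrt_pos.2 hc).ne'
    nth_rewrite 1 [← Real.mul_self_sqrt hc.le]
    field_simp
  have h1 : Real.sqrt c ≠ 0 := (Real.sqrt_pos.2 hc).ne'
  have hcc : c⁻¹ = (Real.sqrt c)⁻¹ * (Real.sqrt c)⁻¹ := by
    rw [← mul_inv, Real.mul_self_sqrt hc.le]
  simp only [meanCurvature, hco, hno, christoffel_smul hy hG hc.ne', inv_smul_matrix hG hc.ne',
    Matrix.smul_apply, smul_eq_mul, hcc]
  rw [mul_left_comm]
  congr 1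
  rw [Finset.mul_sum]
  refine Finset.sum_congr rfl fun i _ => ?_
  rw [Finset.mul_sum]
  refine Finset.sum_congr rfl fun j _ => ?_
  rw [show ∑ k, christoffel G k i j y * (Real.sqrt c * outerConormal G y k)
    = Real.sqrt c * ∑ k, christoffel G k i j y * outerConormal G y k by
      rw [Finset.mul_sum]; exact Finset.sum_congr rfl fun k _ => by ring]
  field_simp

end Scaling

/-! ### Variation of the mean curvature -/

section Variation

variable {n : ℕ} [NeZero n] {G G' : EuclideanSpace ℝ (Fin n) → Matrix (Fin n) (Fin n) ℝ}
  {y : EuclideanSpace ℝ (Fin n)}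

/-- If two metrics agree at `y` and their first derivatives differ there by those of the conformal
factor `1 - s y₀`, then their mean curvatures differ by `(s / 2) √g⁰⁰`. -/
theorem meanCurvature_eq_add_of_partialDeriv (hn : 2 ≤ n) (hdet : IsUnit (G y).det)
    (hsymm : (G y).IsSymm) (hpos : 0 < (G y)⁻¹ 0 0) (hGG : G' y = G y) {s : ℝ}
    (hd : ∀ i a b, partialDeriv i (fun z => G' z a b) y
      = partialDeriv i (fun z => G z a b) y - (if i = 0 then s else 0) * G y a b) :
    meanCurvature G' y = meanCurvature G y + s / 2 * Real.sqrt ((G y)⁻¹ 0 0) := by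
  set H := G y with hH
  set h := H⁻¹ 0 0 with hh
  have hsq : Real.sqrt h * Real.sqrt h = h := Real.mul_self_sqrt hpos.le
  have hs0 : Real.sqrt h ≠ 0 := (Real.sqrt_pos.2 hpos).ne'
  have hinv : ∀ k j, ∑ l, H⁻¹ k l * H j l = if k = j then 1 else 0 := by
    intro k j
    have := congrFun (congrFun (Matrix.nonsing_inv_mul H hdet) k) j
    rw [Matrix.mul_apply, Matrix.one_apply] at this
    rw [← this]
    exact Finset.sum_congr rfl fun l _ => by rw [hsymm.apply]
  have hno : ∀ k, outerNormal G y k = -(H⁻¹ k 0 / Real.sqrt h) := by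
    intro k
    simp only [outerNormal, outerConormal, ← hH, ← hh, mul_ite, mul_zero, Finset.sum_ite_eq',
      Finset.mem_univ, if_true]
    ring
  have hco' : outerConormal G' y = outerConormal G y := by
    funext k; simp only [outerConormal, hGG, ← hH]
  have hno' : outerNormal G' y = outerNormal G y := by
    funext k; simp only [outerNormal, hco', hGG, ← hH]
  -- The only Christoffel symbols that enter are `Γ⁰ᵢⱼ`.
  have hchr : ∀ i j, christoffel G' 0 i j y = christoffel G 0 i j y
      + (1 / 2) * (s * h * H i j - (if i = 0 then s else 0) * (if 0 = j then 1 else 0)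
        - (if j = 0 then s else 0) * (if 0 = i then 1 else 0)) := by
    intro i j
    have e : s * h = ∑ l, H⁻¹ 0 l * (if l = 0 then s else 0) := by
      simp [hh, mul_comm]
    simp only [christoffel, hd, hGG, ← hH]
    have ht : ∀ l, H⁻¹ 0 l * (partialDeriv i (fun z => G z j l) y
          - (if i = 0 then s else 0) * H j l
          + (partialDeriv j (fun z => G z i l) y - (if j = 0 then s else 0) * H i l)
          - (partialDeriv l (fun z => G z i j) y - (if l = 0 then s else 0) * H i j))
        = H⁻¹ 0 l * (partialDeriv i (fun z => G z j l) y + partialDeriv j (fun z => G z i l) y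
          - partialDeriv l (fun z => G z i j) y)
          + ((H⁻¹ 0 l * (if l = 0 then s else 0)) * H i j
            - (if i = 0 then s else 0) * (H⁻¹ 0 l * H j l)
            - (if j = 0 then s else 0) * (H⁻¹ 0 l * H i l)) := fun l => by ring
    simp only [ht, Finset.sum_add_distrib, Finset.sum_sub_distrib, ← Finset.sum_mul,
      ← Finset.mul_sum, ← e, hinv]
    ring
  have hT0 : H⁻¹ 0 0 - outerNormal G y 0 * outerNormal G y 0 = 0 := by
    rw [hno, ← hh, neg_mul_neg, div_mul_div_comm, hsq]
    field_simp
    ring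
  have hTH : ∑ i, ∑ j, (H⁻¹ i j - outerNormal G y i * outerNormal G y j) * H i j = (n : ℝ) - 1 := by
    have e1 : ∑ i, ∑ j, H⁻¹ i j * H i j = (n : ℝ) := by simp [hinv]
    have e2 : ∑ i, ∑ j, (outerNormal G y i * outerNormal G y j) * H i j = 1 := by
      have hsi : ∀ j, H⁻¹ j 0 = H⁻¹ 0 j := fun j => by
        have : (H⁻¹).transpose = H⁻¹ := by rw [Matrix.transpose_nonsing_inv, hsymm]
        exact congrFun (congrFun this 0) j
      have : ∀ i, ∑ j, (outerNormal G y i * outerNormal G y j) * H i j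
          = H⁻¹ i 0 / h * if 0 = i then 1 else 0 := by
        intro i
        rw [← hinv 0 i, Finset.mul_sum]
        refine Finset.sum_congr rfl fun j _ => ?_
        rw [hno, hno, hsi j, neg_mul_neg, div_mul_div_comm, hsq]
        ring
      simp only [this]
      simp [← hh, hpos.ne']
    simp only [sub_mul, Finset.sum_sub_distrib, e1, e2]
  have hsum : ∀ F : EuclideanSpace ℝ (Fin n) → Matrix (Fin n) (Fin n) ℝ, ∀ i j,
      -∑ k, christoffel F k i j y * outerConormal G y k = christoffel F 0 i j y / Real.sqrt h := by
    intro F i j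
    simp only [outerConormal, ← hH, ← hh, mul_ite, mul_zero, Finset.sum_ite_eq', Finset.mem_univ,
      if_true]
    ring
  have hn1 : (n : ℝ) - 1 ≠ 0 := by
    have : (2 : ℝ) ≤ n := by exact_mod_cast hn
    linarith
  have hvar : ∑ i, ∑ j, (H⁻¹ i j - outerNormal G y i * outerNormal G y j)
      * ((1 / 2) * (s * h * H i j - (if i = 0 then s else 0) * (if 0 = j then 1 else 0)
        - (if j = 0 then s else 0) * (if 0 = i then 1 else 0)) / Real.sqrt h)
      = s * h / (2 * Real.sqrt h) * ((n : ℝ) - 1) := by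
    rw [← hTH, Finset.mul_sum]
    refine Finset.sum_congr rfl fun i _ => ?_
    rw [Finset.mul_sum]
    refine Finset.sum_congr rfl fun j _ => ?_
    by_cases hi : i = 0
    · by_cases hj : j = 0
      · subst hi; subst hj
        rw [hT0]; ring
      · simp only [hj, Ne.symm hj, if_false]; ring
    · simp only [hi, Ne.symm hi, if_false]; ring
  simp only [meanCurvature, hGG, hco', hno', ← hH, hsum, hchr]
  simp only [add_div, mul_add, Finset.sum_add_distrib]
  rw [hvar]
  congr 1
  field_simp
  rw [sq, hsq]

end Variation

/-! ### The metric in a chart -/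

section Chart

variable {n : ℕ} [NeZero n] {M : Type*} [TopologicalSpace M]
  [ChartedSpace (EuclideanHalfSpace n) M] [IsManifold (𝓡∂ n) ∞ M]

theorem contMDiffWithinAt_coordVector {x₀ : M} {y : EuclideanSpace ℝ (Fin n)}
    (hy : y ∈ (extChartAt (𝓡∂ n) x₀).target) (i : Fin n) :
    ContMDiffWithinAt 𝓘(ℝ, EuclideanSpace ℝ (Fin n)) (𝓡∂ n).tangent 2
      (fun z => (⟨(extChartAt (𝓡∂ n) x₀).symm z,
        coordVector (chartAt (EuclideanHalfSpace n) x₀) z i⟩ : TangentBundle (𝓡∂ n) M))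
      (Set.range (𝓡∂ n)) y := by
  have hsub : (extChartAt (𝓡∂ n) x₀).target ⊆ Set.range (𝓡∂ n) := extChartAt_target_subset_range x₀
  have hu : UniqueMDiffOn 𝓘(ℝ, EuclideanSpace ℝ (Fin n)) (extChartAt (𝓡∂ n) x₀).target :=
    (uniqueDiffOn_extChartAt_target x₀).uniqueMDiffOn
  have h1 := (contMDiffOn_extChartAt_symm (I := 𝓡∂ n) (n := 3)
    x₀).contMDiffOn_tangentMapWithin (m := 2) (by norm_num) hu
  have h2 : ContMDiffWithinAt 𝓘(ℝ, EuclideanSpace ℝ (Fin n))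
      𝓘(ℝ, EuclideanSpace ℝ (Fin n)).tangent 2
      (fun z => (⟨z, EuclideanSpace.single i (1 : ℝ)⟩ :
        TangentBundle 𝓘(ℝ, EuclideanSpace ℝ (Fin n)) (EuclideanSpace ℝ (Fin n))))
            (extChartAt (𝓡∂ n) x₀).target y :=
    contMDiffWithinAt_vectorSpace_iff_contDiffWithinAt.2 contDiffWithinAt_const
  have h3 := (h1 ⟨y, EuclideanSpace.single i (1 : ℝ)⟩ hy).comp y h2 (fun z hz => hz)
  have h4 := h3.mono_of_mem_nhdsWithin (extChartAt_target_mem_nhdsWithin_of_mem hy)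
  refine h4.congr_of_eventuallyEq_of_mem ?_ (hsub hy)
  filter_upwards [extChartAt_target_mem_nhdsWithin_of_mem hy] with z hz
  have h5 : mfderivWithin 𝓘(ℝ, EuclideanSpace ℝ (Fin n)) (𝓡∂ n) (extChartAt (𝓡∂ n) x₀).symm
      (extChartAt (𝓡∂ n) x₀).target z
      = mfderivWithin 𝓘(ℝ, EuclideanSpace ℝ (Fin n)) (𝓡∂ n) (extChartAt (𝓡∂ n) x₀).symm
        (Set.range (𝓡∂ n)) z :=
    (mdifferentiableWithinAt_extChartAt_symm hz).mfderivWithin_mono (hu z hz) hsub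
  simp only [Function.comp_apply, tangentMapWithin, h5]
  rfl

theorem contDiffWithinAt_coordMatrix (g : Bundle.ContMDiffRiemannianMetric (𝓡∂ n) ∞
      (EuclideanSpace ℝ (Fin n)) (fun x : M => TangentSpace (𝓡∂ n) x)) {x₀ : M}
    {y : EuclideanSpace ℝ (Fin n)} (hy : y ∈ (extChartAt (𝓡∂ n) x₀).target) (i j : Fin n) :
    ContDiffWithinAt ℝ 2
      (fun z => coordMatrix g.inner (chartAt (EuclideanHalfSpace n) x₀) z i j)
      (Set.range (𝓡∂ n)) y := by
  have hb : ContMDiffWithinAt 𝓘(ℝ, EuclideanSpace ℝ (Fin n)) (𝓡∂ n) 2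
      (extChartAt (𝓡∂ n) x₀).symm (Set.range (𝓡∂ n)) y :=
    (contMDiffOn_extChartAt_symm x₀ y hy).mono_of_mem_nhdsWithin
      (extChartAt_target_mem_nhdsWithin_of_mem hy)
  have h1 : ContMDiffWithinAt 𝓘(ℝ, EuclideanSpace ℝ (Fin n)) ((𝓡∂ n).prod 𝓘(ℝ, ℝ)) 2
      (fun z => Bundle.TotalSpace.mk' ℝ (E := Bundle.Trivial M ℝ) ((extChartAt (𝓡∂ n) x₀).symm z)
        (g.inner ((extChartAt (𝓡∂ n) x₀).symm z)
          (coordVector (chartAt (EuclideanHalfSpace n) x₀) z i)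
          (coordVector (chartAt (EuclideanHalfSpace n) x₀) z j))) (Set.range (𝓡∂ n)) y := by
    apply ContMDiffWithinAt.clm_bundle_apply₂ (F₁ := EuclideanSpace ℝ (Fin n))
      (F₂ := EuclideanSpace ℝ (Fin n))
    · exact ContMDiffAt.comp_contMDiffWithinAt y
        (g.contMDiff.of_le (by norm_cast)).contMDiffAt hb
    · exact contMDiffWithinAt_coordVector hy i
    · exact contMDiffWithinAt_coordVector hy j
  rw [Bundle.contMDiffWithinAt_totalSpace] at h1
  exact h1.2.contDiffWithinAt

theorem bilin_sum_smul_sum_smul {F ι : Type*} [AddCommGroup F] [Module ℝ F] [TopologicalSpace F]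
    [IsTopologicalAddGroup F] [ContinuousSMul ℝ F] [Fintype ι] (B : F →L[ℝ] F →L[ℝ] ℝ) (v : ι → ℝ)
    (w : ι → F) :
    B (∑ i, v i • w i) (∑ i, v i • w i) = ∑ i, ∑ j, v i * (B (w i) (w j) * v j) := by
  simp only [map_sum, sum_apply, map_smul, smul_apply, smul_eq_mul, Finset.mul_sum]
  rw [Finset.sum_comm]
  refine Finset.sum_congr rfl fun i _ => Finset.sum_congr rfl fun j _ => ?_
  ring

theorem posDef_coordMatrix (g : Bundle.ContMDiffRiemannianMetric (𝓡∂ n) ∞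
      (EuclideanSpace ℝ (Fin n)) (fun x : M => TangentSpace (𝓡∂ n) x)) {x₀ : M}
    {y : EuclideanSpace ℝ (Fin n)} (hy : y ∈ (extChartAt (𝓡∂ n) x₀).target) :
    (coordMatrix g.inner (chartAt (EuclideanHalfSpace n) x₀) y).PosDef := by
  have hL := isInvertible_mfderivWithin_extChartAt_symm (I := 𝓡∂ n) hy
  set L := mfderivWithin 𝓘(ℝ, EuclideanSpace ℝ (Fin n)) (𝓡∂ n) (extChartAt (𝓡∂ n) x₀).symm
    (Set.range (𝓡∂ n)) y
  have hinj : Function.Injective L := hL.injective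
  refine Matrix.PosDef.of_dotProduct_mulVec_pos ?_ fun v hv => ?_
  · ext i j
    exact g.symm _ _ _
  · have hv' : L (WithLp.toLp 2 v) ≠ 0 := by
      intro h
      apply hv
      have := hinj (h.trans (map_zero L).symm)
      exact (WithLp.toLp_eq_zero 2).1 this
    have e : L (WithLp.toLp 2 v)
        = ∑ i, v i • coordVector (chartAt (EuclideanHalfSpace n) x₀) y i := by
      have : WithLp.toLp 2 v = ∑ i, v i • (EuclideanSpace.single i (1 : ℝ)) := by
        ext i
        simp [Pi.single_apply]
      rw [this]
      exact (map_sum L _ _).trans (Finset.sum_congr rfl fun i _ => map_smul L _ _)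
    have hp := g.pos _ _ hv'
    rw [e] at hp
    refine (hp.trans_eq (bilin_sum_smul_sum_smul (F := TangentSpace (𝓡∂ n) _) _ v _)).trans_eq ?_
    simp only [dotProduct, Matrix.mulVec, star_trivial, Finset.mul_sum]
    rfl

end Chart

/-! ### Conformal metrics in a chart -/

section Conformal

open Filter

variable {n : ℕ} [NeZero n] {M : Type*} [TopologicalSpace M]
  [ChartedSpace (EuclideanHalfSpace n) M]

theorem coordMatrix_conformal (g : BilinField n M) (u : M → ℝ)
    (e : OpenPartialHomeomorph M (EuclideanHalfSpace n)) (y : EuclideanSpace ℝ (Fin n)) :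
    coordMatrix (conformal g u) e y
      = (u ((e.extend (𝓡∂ n)).symm y) ^ (4 / ((n : ℝ) - 2))) • coordMatrix g e y :=
  rfl

theorem coordMatrix_conformal_const_mul (g : BilinField n M) {v : M → ℝ} {c : ℝ} (hc : 0 ≤ c)
    (hv : ∀ x, 0 ≤ v x) (e : OpenPartialHomeomorph M (EuclideanHalfSpace n)) :
    coordMatrix (conformal g fun x => c * v x) e
      = fun y => c ^ (4 / ((n : ℝ) - 2)) • coordMatrix (conformal g v) e y := by
  funext y
  rw [coordMatrix_conformal, coordMatrix_conformal, smul_smul, Real.mul_rpow hc (hv _)]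

theorem partialDeriv_rpow_mul {f G : EuclideanSpace ℝ (Fin n) → ℝ} {y : EuclideanSpace ℝ (Fin n)}
    (hy : y ∈ Set.range (𝓡∂ n)) (hf : DifferentiableWithinAt ℝ f (Set.range (𝓡∂ n)) y)
    (hG : DifferentiableWithinAt ℝ G (Set.range (𝓡∂ n)) y) (h0 : f y ≠ 0) (p : ℝ) (i : Fin n) :
    partialDeriv i (fun z => f z ^ p * G z) y
      = p * f y ^ (p - 1) * partialDeriv i f y * G y + f y ^ p * partialDeriv i G y := by
  have h := (hf.hasFDerivWithinAt.rpow_const (p := p) (Or.inl h0)).mul hG.hasFDerivWithinAt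
  unfold partialDeriv
  rw [show (fun z => f z ^ p * G z) = (fun z => f z ^ p) * G from rfl,
    h.fderivWithin ((𝓡∂ n).uniqueDiffOn y hy)]
  simp only [add_apply, smul_apply, smul_eq_mul]
  ring

theorem contDiffWithinAt_comp_extChartAt_symm [IsManifold (𝓡∂ n) ∞ M] {w : M → ℝ}
    (hw : ContMDiff (𝓡∂ n) 𝓘(ℝ, ℝ) 2 w) {x₀ : M} {y : EuclideanSpace ℝ (Fin n)}
    (hy : y ∈ (extChartAt (𝓡∂ n) x₀).target) :
    ContDiffWithinAt ℝ 2 (fun z => w ((extChartAt (𝓡∂ n) x₀).symm z)) (Set.range (𝓡∂ n)) y := by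
  have hb : ContMDiffWithinAt 𝓘(ℝ, EuclideanSpace ℝ (Fin n)) (𝓡∂ n) 2
      (extChartAt (𝓡∂ n) x₀).symm (Set.range (𝓡∂ n)) y :=
    (contMDiffOn_extChartAt_symm x₀ y hy).mono_of_mem_nhdsWithin
      (extChartAt_target_mem_nhdsWithin_of_mem hy)
  exact (hw.contMDiffAt.comp_contMDiffWithinAt y hb).contDiffWithinAt

/-- Whether a point is interior can be read off in the chart at a nearby point. -/
theorem mem_interior_of_pos [IsManifold (𝓡∂ n) ∞ M] {x₀ x : M}
    (hx : x ∈ (extChartAt (𝓡∂ n) x₀).source) (h : 0 < extChartAt (𝓡∂ n) x₀ x 0) :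
    x ∈ (𝓡∂ n).interior M := by
  have hx' : x ∈ (chartAt (EuclideanHalfSpace n) x₀).source := by rwa [← extChartAt_source (𝓡∂ n)]
  refine (ModelWithCorners.isInteriorPoint_iff_of_mem_atlas (n := ∞) (by simp)
    (chart_mem_atlas _ x₀) hx').2 ?_
  refine OpenPartialHomeomorph.mem_interior_extend_target _ ((chartAt _ x₀).map_source hx') ?_
  change extChartAt (𝓡∂ n) x₀ x ∈ _
  rw [interior_range_modelWithCornersEuclideanHalfSpace]
  exact h

theorem extChartAt_apply_zero_of_mem_boundary {x₀ : M} (hx : x₀ ∈ (𝓡∂ n).boundary M) :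
    extChartAt (𝓡∂ n) x₀ x₀ 0 = 0 := by
  have h : extChartAt (𝓡∂ n) x₀ x₀ ∈ frontier (Set.range (𝓡∂ n)) := hx
  rw [frontier_range_modelWithCornersEuclideanHalfSpace] at h
  exact h.symm

variable [IsManifold (𝓡∂ n) ∞ M] (g : Bundle.ContMDiffRiemannianMetric (𝓡∂ n) ∞
  (EuclideanSpace ℝ (Fin n)) (fun x : M => TangentSpace (𝓡∂ n) x))

theorem posDef_coordMatrix_conformal {u : M → ℝ} {x₀ : M} {y : EuclideanSpace ℝ (Fin n)}
    (hy : y ∈ (extChartAt (𝓡∂ n) x₀).target) (hu : 0 < u ((extChartAt (𝓡∂ n) x₀).symm y)) :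
    (coordMatrix (conformal g.inner u) (chartAt (EuclideanHalfSpace n) x₀) y).PosDef := by
  rw [coordMatrix_conformal]
  exact (posDef_coordMatrix g hy).smul (Real.rpow_pos_of_pos hu _)

/-- Let `φₖ = w + aₖ q₁ + bₖ q₂ + tₖ` with coefficients tending to `0`. In the chart at `x₀`, the
endomorphisms `G⁻¹ A` of the metrics `φₖ ^ (4 / (n - 2)) g` at points tending to `x₀` converge to
that of `w ^ (4 / (n - 2)) g` at `x₀`: the metric is jointly `C²` in the coefficients and the
point. -/
theorem tendsto_inv_mul_schouten_conformal {w q₁ q₂ : M → ℝ} (hw : ContMDiff (𝓡∂ n) 𝓘(ℝ, ℝ) 2 w)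
    (h₁ : ContMDiff (𝓡∂ n) 𝓘(ℝ, ℝ) 2 q₁) (h₂ : ContMDiff (𝓡∂ n) 𝓘(ℝ, ℝ) 2 q₂) {x₀ : M}
    (hpos : 0 < w x₀) {y : ℕ → EuclideanSpace ℝ (Fin n)} {a b t : ℕ → ℝ}
    (hyr : ∀ k, y k ∈ Set.range (𝓡∂ n))
    (hy : Tendsto y atTop (𝓝 (extChartAt (𝓡∂ n) x₀ x₀))) (ha : Tendsto a atTop (𝓝 0))
    (hb : Tendsto b atTop (𝓝 0)) (ht : Tendsto t atTop (𝓝 0)) :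
    Tendsto (fun k =>
      (coordMatrix (conformal g.inner fun x => w x + a k * q₁ x + b k * q₂ x + t k)
        (chartAt (EuclideanHalfSpace n) x₀) (y k))⁻¹
      * schouten (coordMatrix (conformal g.inner fun x => w x + a k * q₁ x + b k * q₂ x + t k)
        (chartAt (EuclideanHalfSpace n) x₀)) (y k)) atTop
      (𝓝 ((coordMatrix (conformal g.inner w) (chartAt (EuclideanHalfSpace n) x₀)
          (extChartAt (𝓡∂ n) x₀ x₀))⁻¹
        * schouten (coordMatrix (conformal g.inner w) (chartAt (EuclideanHalfSpace n) x₀))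
          (extChartAt (𝓡∂ n) x₀ x₀))) := by
  set y₀ := extChartAt (𝓡∂ n) x₀ x₀ with hy₀
  have hy₀t : y₀ ∈ (extChartAt (𝓡∂ n) x₀).target := mem_extChartAt_target x₀
  have hy₀r : y₀ ∈ Set.range (𝓡∂ n) := extChartAt_target_subset_range x₀ hy₀t
  have hsymm : (extChartAt (𝓡∂ n) x₀).symm y₀ = x₀ := extChartAt_to_inv x₀
  let φ : ℝ × ℝ × ℝ → M → ℝ := fun p x => w x + p.1 * q₁ x + p.2.1 * q₂ x + p.2.2
  have hφ0 : φ 0 = w := by funext x; simp [φ]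
  let F : ℝ × ℝ × ℝ → EuclideanSpace ℝ (Fin n) → Matrix (Fin n) (Fin n) ℝ := fun p =>
    coordMatrix (conformal g.inner (φ p)) (chartAt (EuclideanHalfSpace n) x₀)
  have hsnd : ∀ f : EuclideanSpace ℝ (Fin n) → ℝ,
      ContDiffWithinAt ℝ 2 f (Set.range (𝓡∂ n)) y₀ →
      ContDiffWithinAt ℝ 2 (fun z : (ℝ × ℝ × ℝ) × EuclideanSpace ℝ (Fin n) => f z.2)
        (paramHalfSpace n (ℝ × ℝ × ℝ)) (0, y₀) := fun f hf =>
    ContDiffWithinAt.comp (0, y₀) (g := f) hf contDiffWithinAt_snd fun z hz => hz.2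
  have hsm : ∀ i j, ContDiffWithinAt ℝ 2
      (fun z : (ℝ × ℝ × ℝ) × EuclideanSpace ℝ (Fin n) => F z.1 z.2 i j)
      (paramHalfSpace n (ℝ × ℝ × ℝ)) (0, y₀) := by
    intro i j
    refine ContDiffWithinAt.mul (ContDiffWithinAt.rpow_const_of_ne ?_ ?_)
      (hsnd _ (contDiffWithinAt_coordMatrix g hy₀t i j))
    · exact (((hsnd _ (contDiffWithinAt_comp_extChartAt_symm hw hy₀t)).add
        (contDiff_fst.fst.contDiffWithinAt.mul
          (hsnd _ (contDiffWithinAt_comp_extChartAt_symm h₁ hy₀t)))).add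
        (contDiff_fst.snd.fst.contDiffWithinAt.mul
          (hsnd _ (contDiffWithinAt_comp_extChartAt_symm h₂ hy₀t)))).add
        contDiff_fst.snd.snd.contDiffWithinAt
    · change φ 0 ((extChartAt (𝓡∂ n) x₀).symm y₀) ≠ 0
      rw [hφ0, hsymm]
      exact hpos.ne'
  have hdet : (F 0 y₀).det ≠ 0 := by
    refine (posDef_coordMatrix_conformal g hy₀t ?_).det_pos.ne'
    rw [hφ0, hsymm]
    exact hpos
  have hc := continuousWithinAt_inv_mul_schouten (q := ((0 : ℝ × ℝ × ℝ), y₀)) hy₀r hsm hdet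
  have hseq : Tendsto (fun k => ((a k, b k, t k), y k)) atTop
      (𝓝[paramHalfSpace n (ℝ × ℝ × ℝ)] (0, y₀)) := by
    refine tendsto_nhdsWithin_iff.2 ⟨?_, Eventually.of_forall fun k => ⟨Set.mem_univ _, hyr k⟩⟩
    exact (ha.prodMk_nhds (hb.prodMk_nhds ht)).prodMk_nhds hy
  have := hc.tendsto.comp hseq
  simp only [F, hφ0] at this
  exact this

/-- Multiplying the conformal factor by a constant leaves the Schouten tensor unchanged and rescales
its eigenvalues, so that they stay in the cone `Γ`. -/
theorem exists_eigenvalueVector_const_mul {Γ : Set (Fin n → ℝ)} (hΓ : IsAdmissibleCone Γ)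
    {v : M → ℝ} (hv : ∀ x, 0 < v x) {c : ℝ} (hc : 0 < c) {x₀ : M}
    (h : ∃ l ∈ Γ, IsEigenvalueVector
      (coordMatrix (conformal g.inner v) (chartAt (EuclideanHalfSpace n) x₀)
        (extChartAt (𝓡∂ n) x₀ x₀))
      (schouten (coordMatrix (conformal g.inner v) (chartAt (EuclideanHalfSpace n) x₀))
        (extChartAt (𝓡∂ n) x₀ x₀)) l) :
    ∃ l ∈ Γ, IsEigenvalueVector
      (coordMatrix (conformal g.inner fun x => c * v x) (chartAt (EuclideanHalfSpace n) x₀)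
        (extChartAt (𝓡∂ n) x₀ x₀))
      (schouten (coordMatrix (conformal g.inner fun x => c * v x)
        (chartAt (EuclideanHalfSpace n) x₀)) (extChartAt (𝓡∂ n) x₀ x₀)) l := by
  obtain ⟨l, hl, h⟩ := h
  have hC : 0 < c ^ (4 / ((n : ℝ) - 2)) := Real.rpow_pos_of_pos hc _
  have hy₀t := mem_extChartAt_target (I := 𝓡∂ n) x₀
  have hunit : ∀ y ∈ (extChartAt (𝓡∂ n) x₀).target, IsUnit
      (coordMatrix (conformal g.inner v) (chartAt (EuclideanHalfSpace n) x₀) y).det := fun y hy =>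
    (posDef_coordMatrix_conformal g hy (hv _)).det_pos.ne'.isUnit
  rw [coordMatrix_conformal_const_mul g.inner hc.le fun x => (hv x).le, schouten_smul _
    (extChartAt_target_subset_range x₀ hy₀t) hC.ne']
  · exact ⟨_, hΓ.cone _ (inv_pos.2 hC) l hl, h.smul_metric (hunit _ hy₀t) hC.ne'⟩
  · filter_upwards [extChartAt_target_mem_nhdsWithin_of_mem hy₀t] with y hy using hunit y hy

theorem meanCurvature_const_mul_nonneg {v : M → ℝ} (hv : ∀ x, 0 < v x) {c : ℝ} (hc : 0 < c)
    {x₀ : M}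
    (h : 0 ≤ meanCurvature (coordMatrix (conformal g.inner v) (chartAt (EuclideanHalfSpace n) x₀))
      (extChartAt (𝓡∂ n) x₀ x₀)) :
    0 ≤ meanCurvature (coordMatrix (conformal g.inner fun x => c * v x)
      (chartAt (EuclideanHalfSpace n) x₀)) (extChartAt (𝓡∂ n) x₀ x₀) := by
  have hC : 0 < c ^ (4 / ((n : ℝ) - 2)) := Real.rpow_pos_of_pos hc _
  have hy₀t := mem_extChartAt_target (I := 𝓡∂ n) x₀
  rw [coordMatrix_conformal_const_mul g.inner hc.le fun x => (hv x).le,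
    meanCurvature_smul (extChartAt_target_subset_range x₀ hy₀t)
      (posDef_coordMatrix_conformal g hy₀t (hv _)).det_pos.ne'.isUnit hC]
  exact mul_nonneg (inv_nonneg.2 (Real.sqrt_nonneg _)) h

/-- Decreasing the conformal factor `w` in the inward direction increases the mean curvature. -/
theorem meanCurvature_lt_of_partialDeriv (hn : 3 ≤ n) {w φ : M → ℝ}
    (hw : ContMDiff (𝓡∂ n) 𝓘(ℝ, ℝ) 2 w) (hφ : ContMDiff (𝓡∂ n) 𝓘(ℝ, ℝ) 2 φ) {x₀ : M}
    (hpos : 0 < w x₀) (heq : φ x₀ = w x₀) {r : ℝ} (hr : 0 < r)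
    (hd : ∀ i, partialDeriv i (fun z => φ ((extChartAt (𝓡∂ n) x₀).symm z))
        (extChartAt (𝓡∂ n) x₀ x₀)
      = partialDeriv i (fun z => w ((extChartAt (𝓡∂ n) x₀).symm z)) (extChartAt (𝓡∂ n) x₀ x₀)
        - if i = 0 then r else 0) :
    meanCurvature (coordMatrix (conformal g.inner w) (chartAt (EuclideanHalfSpace n) x₀))
        (extChartAt (𝓡∂ n) x₀ x₀)
      < meanCurvature (coordMatrix (conformal g.inner φ) (chartAt (EuclideanHalfSpace n) x₀))
        (extChartAt (𝓡∂ n) x₀ x₀) := by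
  set y₀ := extChartAt (𝓡∂ n) x₀ x₀ with hy₀
  have hy₀t : y₀ ∈ (extChartAt (𝓡∂ n) x₀).target := mem_extChartAt_target x₀
  have hy₀r : y₀ ∈ Set.range (𝓡∂ n) := extChartAt_target_subset_range x₀ hy₀t
  have hsymm : (extChartAt (𝓡∂ n) x₀).symm y₀ = x₀ := extChartAt_to_inv x₀
  have hw0 : 0 < w ((extChartAt (𝓡∂ n) x₀).symm y₀) := by rwa [hsymm]
  have hφw : φ ((extChartAt (𝓡∂ n) x₀).symm y₀) = w ((extChartAt (𝓡∂ n) x₀).symm y₀) := by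
    rw [hsymm, heq]
  have hP := posDef_coordMatrix_conformal g hy₀t hw0
  have hp : 0 < 4 / ((n : ℝ) - 2) := by
    have : (3 : ℝ) ≤ n := by exact_mod_cast hn
    exact div_pos (by norm_num) (by linarith)
  have hs : 0 < 4 / ((n : ℝ) - 2) * r / w ((extChartAt (𝓡∂ n) x₀).symm y₀) := by positivity
  have hg := fun a b => (contDiffWithinAt_coordMatrix g hy₀t a b).differentiableWithinAt (by simp)
  have hGG : coordMatrix (conformal g.inner φ) (chartAt (EuclideanHalfSpace n) x₀) y₀
      = coordMatrix (conformal g.inner w) (chartAt (EuclideanHalfSpace n) x₀) y₀ := by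
    rw [coordMatrix_conformal, coordMatrix_conformal]
    exact congrArg (fun τ : ℝ => τ ^ (4 / ((n : ℝ) - 2)) • _) hφw
  rw [meanCurvature_eq_add_of_partialDeriv
    (s := 4 / ((n : ℝ) - 2) * r / w ((extChartAt (𝓡∂ n) x₀).symm y₀)) (by omega)
    hP.det_pos.ne'.isUnit (by simpa [Matrix.IsHermitian, Matrix.IsSymm] using hP.isHermitian)
    hP.inv.diag_pos hGG]
  · have := Real.sqrt_pos.2 (hP.inv.diag_pos (i := 0))
    have := mul_pos (half_pos hs) this
    linarith
  · intro i a b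
    have e1 := partialDeriv_rpow_mul hy₀r
      ((contDiffWithinAt_comp_extChartAt_symm hφ hy₀t).differentiableWithinAt (by simp)) (hg a b)
      (hφw ▸ hw0.ne') (4 / ((n : ℝ) - 2)) i
    have e2 := partialDeriv_rpow_mul hy₀r
      ((contDiffWithinAt_comp_extChartAt_symm hw hy₀t).differentiableWithinAt (by simp)) (hg a b)
      hw0.ne' (4 / ((n : ℝ) - 2)) i
    refine e1.trans ?_
    rw [show (fun z => coordMatrix (conformal g.inner w) (chartAt (EuclideanHalfSpace n) x₀) z a b)
      = fun z => w ((extChartAt (𝓡∂ n) x₀).symm z) ^ (4 / ((n : ℝ) - 2)) *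
        coordMatrix g.inner (chartAt (EuclideanHalfSpace n) x₀) z a b from rfl, e2, hd, hφw,
      show coordMatrix (conformal g.inner w) (chartAt (EuclideanHalfSpace n) x₀) y₀ a b
      = w ((extChartAt (𝓡∂ n) x₀).symm y₀) ^ (4 / ((n : ℝ) - 2)) *
        coordMatrix g.inner (chartAt (EuclideanHalfSpace n) x₀) y₀ a b from rfl,
      Real.rpow_sub_one hw0.ne']
    split_ifs
    · field_simp
      ring
    · ring

end Conformal

/-! ### Perturbation at a boundary point and comparison -/

section Comparison

open Filter

variable {n : ℕ} [NeZero n] {M : Type*} [TopologicalSpace M]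
  [ChartedSpace (EuclideanHalfSpace n) M] {x₀ : M}

/-- A smooth function on `M` that equals `|y - y₀|²` near `x₀` in the chart at `x₀` and is cut off
to the constant `1` away from `x₀`, so that it vanishes only at `x₀`. -/
def cutoffSqDist (f : SmoothBumpFunction (𝓡∂ n) x₀) (x : M) : ℝ :=
  f x • (‖extChartAt (𝓡∂ n) x₀ x - extChartAt (𝓡∂ n) x₀ x₀‖ ^ 2 - 1) + 1

/-- A smooth function on `M` that equals the coordinate `y 0` near `x₀` in the chart at `x₀`. -/
def cutoffHeight (f : SmoothBumpFunction (𝓡∂ n) x₀) (x : M) : ℝ :=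
  f x • extChartAt (𝓡∂ n) x₀ x 0

theorem contMDiff_cutoffSqDist [T2Space M] [IsManifold (𝓡∂ n) ∞ M]
    (f : SmoothBumpFunction (𝓡∂ n) x₀) :
    ContMDiff (𝓡∂ n) 𝓘(ℝ, ℝ) 2 (cutoffSqDist f) := by
  refine (ContMDiff.add (f.contMDiff_smul ?_) contMDiff_const).of_le (m := 2) (n := ∞)
    (by norm_cast)
  have h : ContDiff ℝ ∞ fun z : EuclideanSpace ℝ (Fin n) =>
      ‖z - extChartAt (𝓡∂ n) x₀ x₀‖ ^ 2 - 1 :=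
    ((contDiff_id.sub contDiff_const).norm_sq ℝ).sub contDiff_const
  exact h.contMDiff.comp_contMDiffOn contMDiffOn_extChartAt

theorem contMDiff_cutoffHeight [T2Space M] [IsManifold (𝓡∂ n) ∞ M]
    (f : SmoothBumpFunction (𝓡∂ n) x₀) :
    ContMDiff (𝓡∂ n) 𝓘(ℝ, ℝ) 2 (cutoffHeight f) := by
  refine (f.contMDiff_smul ?_).of_le (m := 2) (n := ∞) (by norm_cast)
  have h : ContDiff ℝ ∞ fun z : EuclideanSpace ℝ (Fin n) => z 0 :=
    (EuclideanSpace.proj (𝕜 := ℝ) (0 : Fin n)).contDiff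
  exact h.contMDiff.comp_contMDiffOn contMDiffOn_extChartAt

theorem cutoffSqDist_self (f : SmoothBumpFunction (𝓡∂ n) x₀) : cutoffSqDist f x₀ = 0 := by
  simp [cutoffSqDist]

theorem cutoffHeight_self (f : SmoothBumpFunction (𝓡∂ n) x₀) (hx : x₀ ∈ (𝓡∂ n).boundary M) :
    cutoffHeight f x₀ = 0 := by
  rw [cutoffHeight, extChartAt_apply_zero_of_mem_boundary hx, smul_zero]

/-- If the squared distance term at `x` is at most `δ` times the height, then `x` lies in the chart
at `x₀`, at distance and height at most `δ`, and it is either `x₀` or an interior point: on the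
boundary the height vanishes, so that the distance does too. -/
theorem mem_source_of_cutoffSqDist_le [IsManifold (𝓡∂ n) ∞ M] (f : SmoothBumpFunction (𝓡∂ n) x₀)
    (hx₀ : x₀ ∈ (𝓡∂ n).boundary M) {δ : ℝ} (hδ : 0 < δ) {x : M}
    (h : cutoffSqDist f x ≤ δ * cutoffHeight f x) :
    x ∈ (chartAt (EuclideanHalfSpace n) x₀).source ∧
      ‖extChartAt (𝓡∂ n) x₀ x - extChartAt (𝓡∂ n) x₀ x₀‖ ≤ δ ∧
      cutoffHeight f x ≤ δ ∧
      (x = x₀ ∨ x ∈ (𝓡∂ n).interior M) := by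
  simp only [cutoffSqDist, cutoffHeight, smul_eq_mul] at h ⊢
  have hf1 := f.le_one (x := x)
  have hf0 : 0 < f x := by
    refine lt_of_le_of_ne f.nonneg fun h0 => ?_
    rw [← h0] at h
    linarith
  have hsrc : x ∈ (chartAt (EuclideanHalfSpace n) x₀).source :=
    f.support_subset_source (Function.mem_support.2 hf0.ne')
  have hsrc' : x ∈ (extChartAt (𝓡∂ n) x₀).source := by rwa [extChartAt_source]
  set ρ := ‖extChartAt (𝓡∂ n) x₀ x - extChartAt (𝓡∂ n) x₀ x₀‖ with hρ
  have hρ0 : 0 ≤ ρ := norm_nonneg _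
  have h1 : ρ ^ 2 ≤ δ * extChartAt (𝓡∂ n) x₀ x 0 := by
    have : f x * ρ ^ 2 ≤ f x * (δ * extChartAt (𝓡∂ n) x₀ x 0) := by nlinarith
    exact le_of_mul_le_mul_left this hf0
  have h2 : extChartAt (𝓡∂ n) x₀ x 0 ≤ ρ := by
    have := PiLp.norm_apply_le (extChartAt (𝓡∂ n) x₀ x - extChartAt (𝓡∂ n) x₀ x₀) 0
    rw [PiLp.sub_apply, extChartAt_apply_zero_of_mem_boundary hx₀, sub_zero] at this
    exact (le_abs_self _).trans this
  have h3 : ρ ≤ δ := by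
    rcases hρ0.eq_or_lt with h0 | h0
    · rw [← h0]; exact hδ.le
    · have : ρ * ρ ≤ δ * ρ := by nlinarith
      exact le_of_mul_le_mul_right this h0
  have h4 : 0 ≤ extChartAt (𝓡∂ n) x₀ x 0 := by
    have := extChartAt_target_subset_range (I := 𝓡∂ n) x₀ ((extChartAt (𝓡∂ n) x₀).map_source hsrc')
    rwa [range_modelWithCornersEuclideanHalfSpace] at this
  refine ⟨hsrc, h3, by nlinarith, ?_⟩
  rcases h4.eq_or_lt with h0 | h0
  · left
    have : ρ = 0 := by nlinarith
    exact (extChartAt (𝓡∂ n) x₀).injOn hsrc' (mem_extChartAt_source x₀)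
      (sub_eq_zero.1 (norm_eq_zero.1 this))
  · exact Or.inr (mem_interior_of_pos hsrc' h0)

/-- At `x₀` the perturbation changes only the inward derivative of `w`. -/
theorem partialDeriv_add_cutoff [IsManifold (𝓡∂ n) ∞ M] (f : SmoothBumpFunction (𝓡∂ n) x₀)
    {w : M → ℝ} (hw : ContMDiff (𝓡∂ n) 𝓘(ℝ, ℝ) 2 w) (a b t : ℝ) (i : Fin n) :
    partialDeriv i (fun z => w ((extChartAt (𝓡∂ n) x₀).symm z)
        + a * cutoffSqDist f ((extChartAt (𝓡∂ n) x₀).symm z)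
        + b * cutoffHeight f ((extChartAt (𝓡∂ n) x₀).symm z) + t) (extChartAt (𝓡∂ n) x₀ x₀)
      = partialDeriv i (fun z => w ((extChartAt (𝓡∂ n) x₀).symm z)) (extChartAt (𝓡∂ n) x₀ x₀)
        - if i = 0 then -b else 0 := by
  set y₀ := extChartAt (𝓡∂ n) x₀ x₀ with hy₀
  have hy₀t : y₀ ∈ (extChartAt (𝓡∂ n) x₀).target := mem_extChartAt_target x₀
  have hy₀r : y₀ ∈ Set.range (𝓡∂ n) := extChartAt_target_subset_range x₀ hy₀t
  have hev : ∀ᶠ z in 𝓝[Set.range (𝓡∂ n)] y₀, f ((extChartAt (𝓡∂ n) x₀).symm z) = 1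
      ∧ extChartAt (𝓡∂ n) x₀ ((extChartAt (𝓡∂ n) x₀).symm z) = z := by
    have hc : Tendsto (extChartAt (𝓡∂ n) x₀).symm (𝓝[Set.range (𝓡∂ n)] y₀) (𝓝 x₀) := by
      have := (continuousAt_extChartAt_symm (I := 𝓡∂ n) x₀).tendsto
      rw [extChartAt_to_inv] at this
      exact this.mono_left nhdsWithin_le_nhds
    filter_upwards [hc.eventually f.eventuallyEq_one, extChartAt_target_mem_nhdsWithin x₀]
      with z h1 h2 using ⟨h1, (extChartAt (𝓡∂ n) x₀).right_inv h2⟩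
  have h1 : HasFDerivWithinAt (fun z => cutoffSqDist f ((extChartAt (𝓡∂ n) x₀).symm z))
      (0 : EuclideanSpace ℝ (Fin n) →L[ℝ] ℝ) (Set.range (𝓡∂ n)) y₀ := by
    have h : HasFDerivWithinAt (fun z : EuclideanSpace ℝ (Fin n) => ‖z - y₀‖ ^ 2)
        (0 : EuclideanSpace ℝ (Fin n) →L[ℝ] ℝ) (Set.range (𝓡∂ n)) y₀ := by
      have := ((hasFDerivAt_id y₀).sub_const y₀).norm_sq
      simpa using this.hasFDerivWithinAt
    have he : (fun z => cutoffSqDist f ((extChartAt (𝓡∂ n) x₀).symm z))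
        =ᶠ[𝓝[Set.range (𝓡∂ n)] y₀] fun z => ‖z - y₀‖ ^ 2 := hev.mono fun z hz => by
      dsimp only
      rw [cutoffSqDist, hz.1, hz.2, one_smul, sub_add_cancel]
    exact h.congr_of_eventuallyEq he (he.eq_of_nhdsWithin hy₀r)
  have h2 : HasFDerivWithinAt (fun z => cutoffHeight f ((extChartAt (𝓡∂ n) x₀).symm z))
      (EuclideanSpace.proj (𝕜 := ℝ) (0 : Fin n) : EuclideanSpace ℝ (Fin n) →L[ℝ] ℝ)
      (Set.range (𝓡∂ n)) y₀ := by
    have he : (fun z => cutoffHeight f ((extChartAt (𝓡∂ n) x₀).symm z))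
        =ᶠ[𝓝[Set.range (𝓡∂ n)] y₀] EuclideanSpace.proj (𝕜 := ℝ) (0 : Fin n) :=
      hev.mono fun z hz => by
        dsimp only
        rw [cutoffHeight, hz.1, hz.2, one_smul]
        rfl
    exact (EuclideanSpace.proj (𝕜 := ℝ) (0 : Fin n)).hasFDerivWithinAt.congr_of_eventuallyEq he
      (he.eq_of_nhdsWithin hy₀r)
  have h3 := ((contDiffWithinAt_comp_extChartAt_symm hw hy₀t).differentiableWithinAt
    (by simp)).hasFDerivWithinAt
  have h4 := (((h3.add (h1.const_mul a)).add (h2.const_mul b)).add_const t).fderivWithin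
    ((𝓡∂ n).uniqueDiffOn y₀ hy₀r)
  unfold partialDeriv
  refine (congrArg (fun L => L (EuclideanSpace.single i 1)) h4).trans ?_
  by_cases hi : i = 0
  · subst hi; simp
  · simp [hi, Ne.symm hi]

/-- If the eigenvalues of the Schouten tensor of `w ^ (4 / (n - 2)) g` at `x₀` lie in `Γ`, and the
mean curvature there is nonnegative when `x₀` is a boundary point, then `w` cannot touch from above
at `x₀` a function `u` satisfying the opposite conditions in the viscosity sense. At a boundary
point `u` is touched, near `x₀`, by perturbations of `w` whose mean curvature at `x₀` is
positive. -/
theorem not_touching_from_above [T2Space M] [IsManifold (𝓡∂ n) ∞ M] [CompactSpace M] (hn : 3 ≤ n)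
    (g : Bundle.ContMDiffRiemannianMetric (𝓡∂ n) ∞
      (EuclideanSpace ℝ (Fin n)) (fun x : M => TangentSpace (𝓡∂ n) x))
    {Γ : Set (Fin n → ℝ)} (hΓ : IsAdmissibleCone Γ) {u w : M → ℝ}
    (hu : IsViscositySupersolution Γ g.inner u) (hub : MeanCurvatureNonposViscosity g.inner u)
    (hw : ContMDiff (𝓡∂ n) 𝓘(ℝ, ℝ) 2 w) (hle : ∀ x, u x ≤ w x) (heq : u x₀ = w x₀)
    (hl : ∃ l ∈ Γ, IsEigenvalueVector
      (coordMatrix (conformal g.inner w) (chartAt (EuclideanHalfSpace n) x₀)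
        (extChartAt (𝓡∂ n) x₀ x₀))
      (schouten (coordMatrix (conformal g.inner w) (chartAt (EuclideanHalfSpace n) x₀))
        (extChartAt (𝓡∂ n) x₀ x₀)) l)
    (hh : x₀ ∈ (𝓡∂ n).boundary M → 0 ≤ meanCurvature
      (coordMatrix (conformal g.inner w) (chartAt (EuclideanHalfSpace n) x₀))
      (extChartAt (𝓡∂ n) x₀ x₀)) : False := by
  obtain ⟨l, hlΓ, hl⟩ := hl
  obtain ⟨huc, hupos, hus⟩ := hu
  have hmem := IsManifold.chart_mem_maximalAtlas (I := 𝓡∂ n) (n := ∞) x₀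
  have huniq : ¬ ∃ l' ∈ Γᶜ, IsEigenvalueVector
      (coordMatrix (conformal g.inner w) (chartAt (EuclideanHalfSpace n) x₀)
        (extChartAt (𝓡∂ n) x₀ x₀))
      (schouten (coordMatrix (conformal g.inner w) (chartAt (EuclideanHalfSpace n) x₀))
        (extChartAt (𝓡∂ n) x₀ x₀)) l' := by
    rintro ⟨l', hl'Γ, hl'⟩
    obtain ⟨σ, rfl⟩ := hl.exists_perm hl'
    exact hl'Γ (hΓ.symmetric σ l hlΓ)
  rcases (𝓡∂ n).isInteriorPoint_or_isBoundaryPoint x₀ with hx₀ | hx₀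
  · exact huniq (hus x₀ hx₀ w hw.contMDiffOn heq (Eventually.of_forall hle) _ hmem
      (mem_chart_source _ x₀))
  have f : SmoothBumpFunction (𝓡∂ n) x₀ := Classical.arbitrary _
  -- Test functions `w + δ |y - y₀|² - δ² y 0 + t`: the height term makes the mean curvature at `x₀`
  -- positive, and its coefficient `δ²` forces the touching point to tend to `x₀` as `δ → 0`.
  have hq₁ := contMDiff_cutoffSqDist f
  have hq₂ := contMDiff_cutoffHeight f
  let δ : ℕ → ℝ := fun k => 1 / ((k : ℝ) + 1)
  have hδ : ∀ k, 0 < δ k := fun k => by positivity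
  have hδ1 : ∀ k, δ k ≤ 1 := fun k => by
    simp only [δ]
    rw [div_le_one (by positivity)]
    linarith [Nat.cast_nonneg (α := ℝ) k]
  have hδlim : Tendsto δ atTop (𝓝 0) := tendsto_one_div_add_atTop_nhds_zero_nat
  have hδ2lim : Tendsto (fun k => -(δ k) ^ 2) atTop (𝓝 0) := by
    simpa using (hδlim.pow 2).neg
  have hmax : ∀ k, ∃ x, ∀ z, u z - (w z + δ k * cutoffSqDist f z + -(δ k) ^ 2 * cutoffHeight f z)
      ≤ u x - (w x + δ k * cutoffSqDist f x + -(δ k) ^ 2 * cutoffHeight f x) := by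
    intro k
    have hc : Continuous fun z =>
        u z - (w z + δ k * cutoffSqDist f z + -(δ k) ^ 2 * cutoffHeight f z) :=
      huc.sub ((hw.continuous.add (continuous_const.mul hq₁.continuous)).add
        (continuous_const.mul hq₂.continuous))
    obtain ⟨x, -, hx⟩ := isCompact_univ.exists_isMaxOn ⟨x₀, Set.mem_univ _⟩ hc.continuousOn
    exact ⟨x, fun z => hx (Set.mem_univ z)⟩
  choose x hx using hmax
  let t : ℕ → ℝ := fun k =>
    u (x k) - (w (x k) + δ k * cutoffSqDist f (x k) + -(δ k) ^ 2 * cutoffHeight f (x k))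
  have ht0 : ∀ k, 0 ≤ t k := fun k => by
    have := hx k x₀
    rw [cutoffSqDist_self, cutoffHeight_self f hx₀, heq] at this
    simp only [t]
    linarith
  have hdom : ∀ k, cutoffSqDist f (x k) ≤ δ k * cutoffHeight f (x k) := fun k => by
    have h1 := ht0 k
    have h2 := hle (x k)
    have : δ k * cutoffSqDist f (x k) ≤ δ k * (δ k * cutoffHeight f (x k)) := by
      simp only [t] at h1
      nlinarith
    exact le_of_mul_le_mul_left this (hδ k)
  -- The touching points are interior, or equal to `x₀`.
  have hloc := fun k => mem_source_of_cutoffSqDist_le f hx₀ (hδ k) (hdom k)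
  let φ : ℕ → M → ℝ := fun k z =>
    w z + δ k * cutoffSqDist f z + -(δ k) ^ 2 * cutoffHeight f z + t k
  have hφ : ∀ k, ContMDiff (𝓡∂ n) 𝓘(ℝ, ℝ) 2 (φ k) := fun k =>
    ((hw.add (contMDiff_const.mul hq₁)).add (contMDiff_const.mul hq₂)).add contMDiff_const
  have hφle : ∀ k z, u z ≤ φ k z := fun k z => by
    have := hx k z
    simp only [φ, t]
    linarith
  have hφeq : ∀ k, u (x k) = φ k (x k) := fun k => by simp only [φ, t]; ring
  -- A maximum at `x₀` itself is excluded by the boundary condition.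
  have hne : ∀ k, x k ≠ x₀ := by
    intro k hk
    have h1 := hub x₀ hx₀ (φ k) (hφ k) (hk ▸ hφeq k) (Eventually.of_forall (hφle k)) _ hmem
      (mem_chart_source _ x₀)
    have h2 := meanCurvature_lt_of_partialDeriv g hn hw (hφ k) (heq ▸ hupos x₀)
      ((hk ▸ hφeq k).symm.trans heq) (pow_pos (hδ k) 2) fun i => by
        have := partialDeriv_add_cutoff f hw (δ k) (-(δ k) ^ 2) (t k) i
        rwa [neg_neg] at this
    exact absurd (hh hx₀) (not_le.2 (h2.trans_le h1))
  have hint : ∀ k, x k ∈ (𝓡∂ n).interior M := fun k => (hloc k).2.2.2.resolve_left (hne k)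
  have htlim : Tendsto t atTop (𝓝 0) := by
    refine squeeze_zero ht0 (fun k => ?_) hδlim
    have h1 := hle (x k)
    have h2 := (hloc k).2.2.1
    have h3 : 0 ≤ cutoffSqDist f (x k) := by
      simp only [cutoffSqDist, smul_eq_mul]
      nlinarith [f.le_one (x := x k), f.nonneg (x := x k),
        sq_nonneg ‖extChartAt (𝓡∂ n) x₀ (x k) - extChartAt (𝓡∂ n) x₀ x₀‖,
        mul_nonneg (f.nonneg (x := x k))
          (sq_nonneg ‖extChartAt (𝓡∂ n) x₀ (x k) - extChartAt (𝓡∂ n) x₀ x₀‖)]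
    have h4 : δ k ^ 2 * cutoffHeight f (x k) ≤ δ k ^ 2 * δ k :=
      mul_le_mul_of_nonneg_left h2 (sq_nonneg _)
    have h5 : δ k ^ 2 * δ k ≤ 1 * δ k :=
      mul_le_mul_of_nonneg_right (pow_le_one₀ (hδ k).le (hδ1 k)) (hδ k).le
    have h6 := mul_nonneg (hδ k).le h3
    simp only [t]
    linarith
  have hylim : Tendsto (fun k => extChartAt (𝓡∂ n) x₀ (x k)) atTop
      (𝓝 (extChartAt (𝓡∂ n) x₀ x₀)) := by
    rw [tendsto_iff_norm_sub_tendsto_zero]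
    exact squeeze_zero (fun k => norm_nonneg _) (fun k => (hloc k).2.1) hδlim
  have hyr : ∀ k, extChartAt (𝓡∂ n) x₀ (x k) ∈ Set.range (𝓡∂ n) := fun k => ⟨_, rfl⟩
  -- As `δ → 0`, the eigenvalue vectors outside `Γ` at the touching points produce one at `x₀`.
  refine huniq (exists_isEigenvalueVector_of_tendsto (tendsto_inv_mul_schouten_conformal g hw hq₁
    hq₂ (heq ▸ hupos x₀) hyr hylim hδlim hδ2lim htlim) hΓ.isOpen.isClosed_compl
    (Eventually.frequently (Eventually.of_forall fun k => ?_)))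
  exact hus (x k) (hint k) (φ k) (hφ k).contMDiffOn (hφeq k) (Eventually.of_forall (hφle k)) _ hmem
    (hloc k).1

end Comparison

end GammaType

end

theorem lemma15 (n : ℕ) [NeZero n] (hn : 3 ≤ n)
    (M : Type*) [TopologicalSpace M] [T2Space M] [CompactSpace M] [Nonempty M]
    [ChartedSpace (EuclideanHalfSpace n) M] [IsManifold (𝓡∂ n) ∞ M]
    (g : Bundle.ContMDiffRiemannianMetric (𝓡∂ n) ∞ (EuclideanSpace ℝ (Fin n))
      (fun x : M => TangentSpace (𝓡∂ n) x))
    (Γ : Set (Fin n → ℝ)) (hΓ : GammaType.IsAdmissibleCone Γ) :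
    ¬ (GammaType.IsPositiveType Γ g.inner ∧ GammaType.IsNonpositiveType Γ g.inner) := by
  rintro ⟨⟨v, hv, hvpos, hvS, hvh⟩, u, -, hupos, hu, -, hub⟩
  obtain ⟨x₀, -, hx₀⟩ := isCompact_univ.exists_isMaxOn (Set.univ_nonempty (α := M))
    (hu.1.div hv.continuous fun x => (hvpos x).ne').continuousOn
  have hmem := IsManifold.chart_mem_maximalAtlas (I := 𝓡∂ n) (n := ∞) x₀
  have hc : 0 < u x₀ / v x₀ := div_pos (hupos x₀) (hvpos x₀)
  -- The multiple `(u x₀ / v x₀) * v` of `v` touches `u` from above at `x₀`.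
  refine GammaType.not_touching_from_above (x₀ := x₀) (w := fun x => u x₀ / v x₀ * v x) hn g hΓ hu
    hub (contMDiff_const.mul hv) (fun x => ?_) (div_mul_cancel₀ _ (hvpos x₀).ne').symm
    (GammaType.exists_eigenvalueVector_const_mul g hΓ hvpos hc
      (hvS x₀ _ hmem (mem_chart_source _ x₀)))
    fun hb => GammaType.meanCurvature_const_mul_nonneg g hvpos hc
      (hvh x₀ hb _ hmem (mem_chart_source _ x₀))
  exact (div_le_iff₀ (hvpos x)).1 (hx₀ (Set.mem_univ x))
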